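/- Let $\mathcal W$ be a countable (discrete) source alphabet with source law $P_W$, let $\mathcal X,\mathcal Y,\mathcal T$ be standard Borel spaces, let $P_{Y|X}$ be a channel (Markov kernel) from $\mathcal X$ to $\mathcal Y$, $P_{T|W}$ a Markov kernel from $\mathcal W$ to $\mathcal T$, and let $K$ be the number of decoders. A code without side information consists of a measurable encoder $f:\mathcal W\to\mathcal X$ and measurable decoders $g_k:\mathcal Y\to\mathcal W$, $1\le k\le K$. The source $W\sim P_W$ is encoded as $f(W)$; given $W$, the outputs $Y_1,\dots,Y_K$ are independent with law $P_{Y|X}(\cdot\mid f(W))$, and $\hat Z_k=g_k(Y_k)$. A code with side information has decoders $g_k:\mathcal Y\times\mathcal T\to\mathcal W$ and $\hat Z_k=g_k(Y_k,T_k)$, where, given $W$, all of $Y_1,\dots,Y_K,T_1,\dots,T_K$ are independent with $Y_k\sim P_{Y|X}(\cdot\mid f(W))$ and $T_k\sim P_{T|W}(\cdot\mid W)$. With the Hamming distortion $d(w,z)=\mathbf 1\{w\ne z\}$ and $D=0$, the error probability is $P_e=\Pr\bigl[\bigcap_{k=1}^K\{d(W,\hat Z_k)>D\}\bigr]$, the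 probability that no decoder recovers $W$. Fix a probability measure $P_X$ on $\mathcal X$. Suppose that the joint law $P_XP_{Y|X}$ is absolutely continuous with respect to $\theta_X\times\theta_Y$ for $\sigma$-finite reference measures $\theta_X$ on $\mathcal X$ and $\theta_Y$ on $\mathcal Y$. Let $p_{X,Y},p_X,p_Y$ be the densities of this law and of its marginals, and let $\iota_{X;Y}(x;y)=\log_2\frac{p_{X,Y}(x,y)}{p_X(x)p_Y(y)}$. Then: 1. There is a code without side information such that $$P_e\le \mathbb E\Bigl[\bigl(1+K\,P_W(W)\,2^{\iota_{X;Y}(X;Y)}\bigr)^{-1}\Bigr],\qquad (W,X,Y)\sim P_W\times P_XP_{Y|X}.$$ If $W$ is uniform on a set of cardinality $M$, this code satisfies $$P_e\le \mathbb E\Bigl[\bigl(1+K\,M^{-1}\,2^{\iota_{X;Y}(X;Y)}\bigr)^{-1}\Bigr].$$ 2. There is a code with side information such that $$P_e\le \mathbb E\Bigl[\bigl(1+K\,P_{W|T}(W\mid T)\,2^{\iota_{X;Y}(X;Y)}\bigr)^{-1}\Bigr],\qquad (W,T,X,Y)\sim P_WP_{T|W}\times P_XP_{Y|X},$$ where $P_{W|T}$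 is the conditional distribution of $W$ given $T$ under $P_WP_{T|W}$. -/

import Mathlib

open MeasureTheory ProbabilityTheory
open scoped NNReal ENNReal

namespace BroadcastJSCC

/-- The kernel that sends `a` to the law of `K` independent samples from `κ a`. -/
noncomputable def iidKernel {A B : Type*} [MeasurableSpace A] [MeasurableSpace B]
    (K : ℕ) (κ : Kernel A B) [IsMarkovKernel κ] : Kernel A (Fin K → B) where
  toFun a := Measure.pi fun _ => κ a
  measurable' := by
    refine Measurable.measure_of_isPiSystem_of_isProbabilityMeasure generateFrom_pi.symm
      isPiSystem_pi ?_
    rintro _ ⟨s, hs, rfl⟩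
    simp only [Measure.pi_pi]
    exact Finset.measurable_prod _ fun i _ => κ.measurable_coe (hs i (Set.mem_univ i))

instance {A B : Type*} [MeasurableSpace A] [MeasurableSpace B]
    (K : ℕ) (κ : Kernel A B) [IsMarkovKernel κ] : IsMarkovKernel (iidKernel K κ) :=
  ⟨fun a => inferInstanceAs (IsProbabilityMeasure (Measure.pi fun _ : Fin K => κ a))⟩

/-- A broadcast joint source-channel code with one encoder and `K` decoders: an encoder
`enc : 𝒲 → 𝒳`, and for each `k` a decoder `dec k : 𝒪 → 𝒵`, where `𝒪` is the space of what a single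
decoder observes: `𝒴` without side information, `𝒴 × 𝒯` with side information. -/
structure Code (W X O Z : Type*) [MeasurableSpace W] [MeasurableSpace X] [MeasurableSpace O]
    [MeasurableSpace Z] (K : ℕ) where
  enc : W → X
  measurable_enc : Measurable enc
  dec : Fin K → O → Z
  measurable_dec : ∀ k, Measurable (dec k)

section ErrorProbability

variable {W X Y T Z : Type*} [MeasurableSpace W] [MeasurableSpace X] [MeasurableSpace Y]
  [MeasurableSpace T] [MeasurableSpace Z] {K : ℕ}

/-- The law of `(W, Y_1, …, Y_K)`: `W ∼ P_W` and, given `W`, the `Y_k` are independent with law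
`P_{Y|X}(· | enc W)`. -/
noncomputable def Code.law (c : Code W X Y Z K) (PW : Measure W)
    (PYX : Kernel X Y) [IsMarkovKernel PYX] : Measure (W × (Fin K → Y)) :=
  PW ⊗ₘ iidKernel K (PYX.comap c.enc c.measurable_enc)

/-- `P_e`, the probability that every decoder exceeds distortion `D`, without side information. -/
noncomputable def Code.errorProb (c : Code W X Y Z K) (PW : Measure W)
    (PYX : Kernel X Y) [IsMarkovKernel PYX] (d : W → Z → ℝ≥0) (D : ℝ≥0) : ℝ :=
  (c.law PW PYX).real {p | ∀ k, D < d p.1 (c.dec k (p.2 k))}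

/-- The law of `(W, (Y_1, T_1), …, (Y_K, T_K))`: `W ∼ P_W` and, given `W`, all the `Y_k` and `T_k`
are independent, with laws `P_{Y|X}(· | enc W)` and `P_{T|W}(· | W)`. -/
noncomputable def Code.lawSI (c : Code W X (Y × T) Z K) (PW : Measure W)
    (PYX : Kernel X Y) [IsMarkovKernel PYX] (PTW : Kernel W T) [IsMarkovKernel PTW] :
    Measure (W × (Fin K → Y × T)) :=
  PW ⊗ₘ iidKernel K ((PYX.comap c.enc c.measurable_enc) ×ₖ PTW)

/-- `P_e`, the probability that every decoder exceeds distortion `D`, with side information. -/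
noncomputable def Code.errorProbSI (c : Code W X (Y × T) Z K) (PW : Measure W)
    (PYX : Kernel X Y) [IsMarkovKernel PYX] (PTW : Kernel W T) [IsMarkovKernel PTW]
    (d : W → Z → ℝ≥0) (D : ℝ≥0) : ℝ :=
  (c.lawSI PW PYX PTW).real {p | ∀ k, D < d p.1 (c.dec k (p.2 k))}

end ErrorProbability

open Classical in
/-- Hamming distortion `d(w, z) = 1{w ≠ z}`. -/
noncomputable def hammingDistortion {W : Type*} (w z : W) : ℝ≥0 := if w ≠ z then 1 else 0

/-- The information density `ι(x; y) = log₂ (p_{X,Y}(x, y) / (p_X(x) p_Y(y)))` of a joint law `P` on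
`𝒳 × 𝒴`, where the densities are taken with respect to `θ_X × θ_Y`, `θ_X` and `θ_Y`. Where one of
the densities is `0` or `∞`, which has probability zero under `P` if `P ≪ θ_X × θ_Y`, the value is
immaterial. -/
noncomputable def infoDensity {X Y : Type*} [MeasurableSpace X] [MeasurableSpace Y]
    (θX : Measure X) (θY : Measure Y) (P : Measure (X × Y)) (x : X) (y : Y) : ℝ :=
  Real.logb 2 ((P.rnDeriv (θX.prod θY) (x, y)).toReal /
    ((P.fst.rnDeriv θX x).toReal * (P.snd.rnDeriv θY y).toReal))

end BroadcastJSCC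

/-! Random coding with binning over the decoders. Each symbol `w` gets an independent codeword drawn
from `PX` and an independent uniform index `J w`; decoder `k` maximizes a weighted likelihood among
the symbols with index `k`. If all decoders fail then decoder `J W` fails, so only that one is
analysed (`compProd_iidKernel_forall_ne_le`).

At a fixed observation let `c w` be the weighted likelihoods seen by a decoder and `s w` the sum of
the others. The maximizer errs no more than the randomized decoder choosing `w` with probability
proportional to `c w`, whose error mass is `∑ c w * s w / (c w + s w)`. This is concave in `s w`,
and given the codeword of `w` the mean of `s w` is at most `m = 1 / K`, so Jensen gives `c * m / (c
+ m) = c / (1 + K * c)`. Jensen enters through the tangent at `m` (`tsum_ne_argmax_le`,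
`lintegral_tangentBound_le`), an affine bound that can be integrated term by term.

`exists_codebook` fixes a good codebook and `exists_code` turns it into a code. With `r` the density
of the channel with respect to its output law, the weighted likelihood is `P_W(w) * r` without side
information and `P_{W|T}(w | t) * r` with it; `r` equals `2 ^ ι` almost everywhere. -/

namespace BroadcastJSCC

/-! ### Measurable maximizers over a countable alphabet -/

section Argmax

variable {W O : Type*}

/-- A summable family of nonnegative reals attains its maximum. -/
lemma exists_forall_le_of_tsum_ne_top [Nonempty W] (c : W → ℝ≥0)
    (hc : ∑' w, (c w : ℝ≥0∞) ≠ ∞) : ∃ w, ∀ w', c w' ≤ c w := by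
  by_cases h0 : ∀ w, c w = 0
  · exact ⟨Classical.arbitrary W, fun w' => by simp [h0]⟩
  push Not at h0
  obtain ⟨w₀, hw₀⟩ := h0
  -- Summability forces decay along the cofinite filter, so only finitely many values reach a fixed
  -- positive one.
  have hfin : {w | c w₀ ≤ c w}.Finite := by
    have := (ENNReal.tendsto_cofinite_zero_of_tsum_ne_top hc).eventually_lt_const
      (show (0 : ℝ≥0∞) < c w₀ by exact_mod_cast pos_iff_ne_zero.2 hw₀)
    rw [Filter.eventually_cofinite] at this
    simpa using this
  obtain ⟨w, hw, hmax⟩ := hfin.exists_maximalFor c _ ⟨w₀, le_refl (c w₀)⟩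
  refine ⟨w, fun w' => ?_⟩
  by_cases h : c w₀ ≤ c w'
  · exact (le_total (c w') (c w)).elim id fun h' => hmax h h'
  · exact (not_le.1 h).le.trans hw

/-- Measurable selection of a maximizer from a countable family of measurable functions. -/
lemma exists_measurable_argmax [Nonempty W] [Countable W] [MeasurableSpace W] [MeasurableSpace O]
    (c : W → O → ℝ≥0) (hc : ∀ w, Measurable (c w)) :
    ∃ dec : O → W, Measurable dec ∧
      ∀ o, ∑' w, (c w o : ℝ≥0∞) ≠ ∞ → ∀ w, c w o ≤ c (dec o) o := by
  classical
  obtain ⟨e, he⟩ := exists_surjective_nat W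
  -- The second alternative keeps `Nat.find` total: where no maximizer exists, the index 0 is
  -- selected.
  let p : O → ℕ → Prop := fun o n =>
    (∀ w, c w o ≤ c (e n) o) ∨ ¬ ∃ n, ∀ w, c w o ≤ c (e n) o
  have hp : ∀ o, ∃ n, p o n := fun o => by
    by_cases h : ∃ n, ∀ w, c w o ≤ c (e n) o
    · exact ⟨h.choose, Or.inl h.choose_spec⟩
    · exact ⟨0, Or.inr h⟩
  have hm : ∀ n, MeasurableSet {o | ∀ w, c w o ≤ c (e n) o} := fun n => by
    simp only [Set.ofPred_forall]
    exact MeasurableSet.iInter fun w => measurableSet_le (hc w) (hc (e n))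
  refine ⟨fun o => e (Nat.find (hp o)), ?_, fun o ho w => ?_⟩
  · refine (measurable_from_top (f := e)).comp (measurable_find hp fun n => ?_)
    refine (hm n).union (MeasurableSet.compl ?_)
    have := MeasurableSet.iUnion hm
    rw [← Set.ofPred_exists] at this
    exact this
  · obtain ⟨w₁, hw₁⟩ := exists_forall_le_of_tsum_ne_top (fun w => c w o) ho
    obtain ⟨n, rfl⟩ := he w₁
    rcases Nat.find_spec (hp o) with h | h
    · exact h w
    · exact absurd ⟨n, hw₁⟩ h

end Argmax

/-! ### Maximum versus randomized likelihood decoding -/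

section Pointwise

-- For a finite total `S` this is `∑ c w ^ 2 ≤ c v * S`, rearranged without subtraction. Divided by
-- `S`, it compares the maximizer with the randomized decoder.
open Classical in
lemma mul_sum_ne_le {W : Type*} (c : W → ℝ≥0) (v : W) (hv : ∀ w, c w ≤ c v) :
    (∑' w, (c w : ℝ≥0∞)) * (∑' w, if w = v then 0 else (c w : ℝ≥0∞)) ≤
      ∑' w, (c w : ℝ≥0∞) * ∑' w', if w' = w then 0 else (c w' : ℝ≥0∞) := by
  rw [ENNReal.tsum_eq_add_tsum_ite (f := fun w => (c w : ℝ≥0∞) *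
    ∑' w', if w' = w then 0 else (c w' : ℝ≥0∞)) v, ← ENNReal.tsum_mul_left,
    ← ENNReal.tsum_mul_left, ← ENNReal.tsum_add]
  refine ENNReal.tsum_le_tsum fun w => ?_
  by_cases h : w = v
  · simp [h]
  · simp only [h, if_false]
    rw [ENNReal.tsum_eq_add_tsum_ite (f := fun w => (c w : ℝ≥0∞)) w, add_mul]
    refine add_le_add (mul_le_mul_left (by exact_mod_cast hv w) _) (le_of_eq (mul_comm _ _))

/-- The right side is the tangent at `s = m` of a concave function; the gap comes from `(m - s) ^ 2
≥ 0`. -/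
lemma div_add_le_tangent (c m s : ℝ≥0) (hm : 0 < m) (hc : 0 < c) :
    s / (c + s) ≤ (m ^ 2 + c * s) / (c + m) ^ 2 := by
  rw [div_le_div_iff₀ (by positivity) (by positivity)]
  have h : 2 * (m * s) ≤ m ^ 2 + s ^ 2 := by
    rw [← NNReal.coe_le_coe]; push_cast; nlinarith [sq_nonneg ((m : ℝ) - s)]
  calc s * (c + m) ^ 2 = c * (2 * (m * s)) + (s * c ^ 2 + m ^ 2 * s) := by ring
    _ ≤ c * (m ^ 2 + s ^ 2) + (s * c ^ 2 + m ^ 2 * s) := by gcongr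
    _ = _ := by ring

open Classical in
/-- The mass outside a maximizer is at most the error of the likelihood decoder, bounded by the
tangent of the concave function `s ↦ c s / (c + s)` at `m`. -/
lemma tsum_ne_argmax_le {W : Type*} (c : W → ℝ≥0) (m : ℝ≥0) (hm : 0 < m) (v : W)
    (hv : ∑' w, (c w : ℝ≥0∞) ≠ ∞ → ∀ w, c w ≤ c v) :
    (∑' w, if w = v then 0 else (c w : ℝ≥0∞)) ≤
      ∑' w, ((c w * (m ^ 2 / (c w + m) ^ 2) : ℝ≥0) : ℝ≥0∞) +
        ∑' w, (c w * (c w / (c w + m) ^ 2) : ℝ≥0) *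
          ∑' w', if w' = w then 0 else (c w' : ℝ≥0∞) := by
  -- With infinite total mass nothing is known about `v`, but any `w` with `c w ≠ 0` faces infinite
  -- competing mass, so the right side is infinite.
  by_cases hS : ∑' w, (c w : ℝ≥0∞) = ∞
  · obtain ⟨w, hw⟩ : ∃ w, c w ≠ 0 := by
      by_contra! h
      simp [h] at hS
    have hs : (∑' w', if w' = w then 0 else (c w' : ℝ≥0∞)) = ∞ := by
      rw [ENNReal.tsum_eq_add_tsum_ite w] at hS
      simpa using hS
    have : (∑' w, ((c w * (c w / (c w + m) ^ 2) : ℝ≥0) : ℝ≥0∞) *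
          ∑' w', if w' = w then 0 else (c w' : ℝ≥0∞)) = ∞ := by
      refine top_le_iff.1 (le_trans (le_of_eq ?_) (ENNReal.le_tsum w))
      rw [hs, ENNReal.mul_top]
      have : c w * (c w / (c w + m) ^ 2) ≠ 0 := by positivity
      exact_mod_cast this
    rw [this]; simp
  have hsf : ∀ w, (∑' w', if w' = w then 0 else (c w' : ℝ≥0∞)) ≠ ∞ := fun w h => by
    rw [ENNReal.tsum_eq_add_tsum_ite w] at hS
    simp [h] at hS
  by_cases h0 : ∀ w, c w = 0
  · simp [h0]
  push Not at h0
  obtain ⟨w₀, hw₀⟩ := h0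
  have hS0 : ∑' w, (c w : ℝ≥0∞) ≠ 0 := fun h => hw₀ (by simpa using ENNReal.tsum_eq_zero.1 h w₀)
  have h1 := mul_sum_ne_le c v (hv hS)
  rw [mul_comm, ← ENNReal.le_div_iff_mul_le (Or.inl hS0) (Or.inl hS), div_eq_mul_inv,
    ← ENNReal.tsum_mul_right] at h1
  refine h1.trans ?_
  rw [← ENNReal.tsum_add]
  refine ENNReal.tsum_le_tsum fun w => ?_
  by_cases hw : c w = 0
  · simp [hw]
  have hs : ∑' w, (c w : ℝ≥0∞) = c w + ∑' w', if w' = w then 0 else (c w' : ℝ≥0∞) :=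
    ENNReal.tsum_eq_add_tsum_ite w
  rw [hs]
  lift (∑' w', if w' = w then 0 else (c w' : ℝ≥0∞)) to ℝ≥0 using hsf w with s
  have hcs : c w + s ≠ 0 := by positivity
  rw [← ENNReal.coe_add, ← ENNReal.coe_inv hcs]
  norm_cast
  have h2 := div_add_le_tangent (c w) m s hm (pos_iff_ne_zero.2 hw)
  calc c w * s * (c w + s)⁻¹ = c w * (s / (c w + s)) := by rw [div_eq_mul_inv]; ring
    _ ≤ c w * ((m ^ 2 + c w * s) / (c w + m) ^ 2) := by gcongr
    _ = _ := by rw [add_div]; ring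

end Pointwise

/-! ### Averaging over independent codewords -/

section Expectation

variable {W E : Type*} [MeasurableSpace E]

lemma lintegral_infinitePi_eval (ρ : Measure E) [IsProbabilityMeasure ρ] (w : W) {f : E → ℝ≥0∞}
    (hf : Measurable f) :
    ∫⁻ ω, f (ω w) ∂(Measure.infinitePi fun _ : W => ρ) = ∫⁻ e, f e ∂ρ :=
  (measurePreserving_eval_infinitePi (fun _ : W => ρ) w).lintegral_comp hf

lemma lintegral_infinitePi_eval_mul_eval (ρ : Measure E) [IsProbabilityMeasure ρ] {w w' : W}
    (h : w ≠ w') {f g : E → ℝ≥0∞} (hf : Measurable f) (hg : Measurable g) :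
    ∫⁻ ω, f (ω w) * g (ω w') ∂(Measure.infinitePi fun _ : W => ρ) =
      (∫⁻ e, f e ∂ρ) * ∫⁻ e, g e ∂ρ := by
  have hi := (iIndepFun_infinitePi (P := fun _ : W => ρ) (X := fun _ e => e)
    (fun _ => measurable_id)).indepFun h
  rw [← lintegral_infinitePi_eval ρ w hf, ← lintegral_infinitePi_eval ρ w' hg]
  exact lintegral_mul_eq_lintegral_mul_lintegral_of_indepFun''
    (hf.comp (measurable_pi_apply w)).aemeasurable (hg.comp (measurable_pi_apply w')).aemeasurable
    (hi.comp hf hg)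

open Classical in
/-- The bound of `tsum_ne_argmax_le`, affine in the competing mass of each symbol. -/
noncomputable def tangentBound (m : ℝ≥0) (c : W → ℝ≥0) : ℝ≥0∞ :=
  ∑' w, ((c w * (m ^ 2 / (c w + m) ^ 2) : ℝ≥0) : ℝ≥0∞) +
    ∑' w, (c w * (c w / (c w + m) ^ 2) : ℝ≥0) * ∑' w', if w' = w then 0 else (c w' : ℝ≥0∞)

lemma measurable_tangentBound [Countable W] {A : Type*} [MeasurableSpace A] (m : ℝ≥0)
    {c : A → W → ℝ≥0} (hc : ∀ w, Measurable fun a => c a w) :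
    Measurable fun a => tangentBound m (c a) := by
  unfold tangentBound
  refine Measurable.add (Measurable.tsum (L := .unconditional W) fun w => ?_)
    (Measurable.tsum (L := .unconditional W) fun w => ?_)
  · have := hc w
    fun_prop
  · have := hc w
    refine Measurable.mul (by fun_prop) (Measurable.tsum fun w' => ?_)
    split_ifs
    · exact measurable_const
    · exact (hc w').coe_nnreal_ennreal

/-- Expectation of the tangent bound for independent identically distributed codewords. -/
lemma lintegral_tangentBound_le [Countable W] (ρ : Measure E) [IsProbabilityMeasure ρ]
    (β : W → E → ℝ≥0) (hβ : ∀ w, Measurable (β w)) (m : ℝ≥0) (hm : 0 < m)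
    (hsum : ∑' w, ∫⁻ e, β w e ∂ρ ≤ m) :
    ∫⁻ ω, tangentBound m (fun w => β w (ω w)) ∂(Measure.infinitePi fun _ : W => ρ) ≤
      ∑' w, ∫⁻ e, (β w e * (m / (β w e + m)) : ℝ≥0) ∂ρ := by
  classical
  have hf : ∀ w, Measurable fun e => ((β w e * (β w e / (β w e + m) ^ 2) : ℝ≥0) : ℝ≥0∞) :=
    fun w => by have := hβ w; fun_prop
  have hg : ∀ w, Measurable fun e => ((β w e * (m ^ 2 / (β w e + m) ^ 2) : ℝ≥0) : ℝ≥0∞) :=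
    fun w => by have := hβ w; fun_prop
  have hb : ∀ w, Measurable fun e => (β w e : ℝ≥0∞) := fun w => (hβ w).coe_nnreal_ennreal
  have hterm : ∀ w w', Measurable fun ω : W → E =>
      if w' = w then 0 else (β w' (ω w') : ℝ≥0∞) := fun w w' => by
    split_ifs
    · exact measurable_const
    · exact (hb w').comp (measurable_pi_apply w')
  have hf' : ∀ w, Measurable fun ω : W → E =>
      ((β w (ω w) * (β w (ω w) / (β w (ω w) + m) ^ 2) : ℝ≥0) : ℝ≥0∞) :=
    fun w => (hf w).comp (measurable_pi_apply w)
  have hg' : ∀ w, Measurable fun ω : W → E =>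
      ((β w (ω w) * (m ^ 2 / (β w (ω w) + m) ^ 2) : ℝ≥0) : ℝ≥0∞) :=
    fun w => (hg w).comp (measurable_pi_apply w)
  have hcross : ∀ w, ∫⁻ ω : W → E, (β w (ω w) * (β w (ω w) / (β w (ω w) + m) ^ 2) : ℝ≥0) *
      (∑' w', if w' = w then 0 else (β w' (ω w') : ℝ≥0∞)) ∂(Measure.infinitePi fun _ : W => ρ) ≤
      (∫⁻ e, (β w e * (β w e / (β w e + m) ^ 2) : ℝ≥0) ∂ρ) * m := fun w => by
    simp_rw [← ENNReal.tsum_mul_left]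
    have hp : ∀ w', AEMeasurable (fun ω : W → E =>
        ((β w (ω w) * (β w (ω w) / (β w (ω w) + m) ^ 2) : ℝ≥0) : ℝ≥0∞) *
          if w' = w then 0 else (β w' (ω w') : ℝ≥0∞)) (Measure.infinitePi fun _ : W => ρ) :=
      fun w' => ((hf' w).mul (hterm w w')).aemeasurable
    rw [lintegral_tsum hp]
    -- The full sum may replace the sum over `w' ≠ w`: the diagonal term is zero on the left, and
    -- the others factor by independence.
    refine le_trans ?_ (mul_le_mul_right hsum _)
    rw [← ENNReal.tsum_mul_left]
    refine ENNReal.tsum_le_tsum fun w' => ?_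
    by_cases h : w' = w
    · simp [h]
    · simp only [h, if_false]
      exact (lintegral_infinitePi_eval_mul_eval ρ (Ne.symm h) (hf w) (hb w')).le
  have hp : ∀ w, AEMeasurable (fun ω : W → E =>
      ((β w (ω w) * (β w (ω w) / (β w (ω w) + m) ^ 2) : ℝ≥0) : ℝ≥0∞) *
        ∑' w', if w' = w then 0 else (β w' (ω w') : ℝ≥0∞)) (Measure.infinitePi fun _ : W => ρ) :=
    fun w => ((hf' w).mul (Measurable.tsum (hterm w))).aemeasurable
  unfold tangentBound
  rw [lintegral_add_left (Measurable.tsum hg'), lintegral_tsum fun w => (hg' w).aemeasurable,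
    lintegral_tsum hp, ← ENNReal.tsum_add]
  refine ENNReal.tsum_le_tsum fun w => (add_le_add
    (lintegral_infinitePi_eval ρ w (hg w)).le (hcross w)).trans (le_of_eq ?_)
  -- At `s = m` the tangent meets the curve: `c * (m ^ 2 + c * m) / (c + m) ^ 2 = c * m / (c + m)`.
  rw [← lintegral_mul_const _ (hf w), ← lintegral_add_left (hg w)]
  refine lintegral_congr fun e => ?_
  norm_cast
  have : β w e + m ≠ 0 := by positivity
  field_simp
  ring

end Expectation

/-! ### Random codebooks with decoder indices -/

section Codebook

variable {W X O : Type*} [MeasurableSpace X] [MeasurableSpace O]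

/-- The law of a random codeword with a uniformly distributed decoder index. -/
noncomputable def indexedLaw (PX : Measure X) (K : ℕ) : Measure (X × Fin K) :=
  PX.prod ((K : ℝ≥0∞)⁻¹ • Measure.count)

instance (PX : Measure X) [IsProbabilityMeasure PX] (K : ℕ) [NeZero K] :
    IsProbabilityMeasure (indexedLaw PX K) := by
  have : IsProbabilityMeasure ((K : ℝ≥0∞)⁻¹ • (Measure.count : Measure (Fin K))) := ⟨by
    simp [Measure.count_univ, ENNReal.inv_mul_cancel, NeZero.ne K]⟩
  unfold indexedLaw
  infer_instance

instance (K : ℕ) [NeZero K] :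
    IsFiniteMeasure ((K : ℝ≥0∞)⁻¹ • (Measure.count : Measure (Fin K))) :=
  ⟨by simp [Measure.count_univ, ENNReal.inv_mul_cancel, NeZero.ne K]⟩

lemma lintegral_indexedLaw (PX : Measure X) [SFinite PX] (K : ℕ) [NeZero K] (k : Fin K)
    {f : X → ℝ≥0∞} (hf : Measurable f) :
    ∫⁻ e, (if e.2 = k then f e.1 else 0) ∂(indexedLaw PX K) = (K : ℝ≥0∞)⁻¹ * ∫⁻ x, f x ∂PX := by
  have hm : Measurable fun e : X × Fin K => if e.2 = k then f e.1 else 0 :=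
    Measurable.ite (measurable_snd (measurableSet_singleton k)) (hf.comp measurable_fst)
      measurable_const
  rw [indexedLaw, lintegral_prod _ hm.aemeasurable, ← lintegral_const_mul _ hf]
  refine lintegral_congr fun x => ?_
  simp [lintegral_smul_measure, lintegral_count]

lemma ae_infinitePi_indexedLaw [Countable W] (PX : Measure X) [IsProbabilityMeasure PX] (K : ℕ)
    [NeZero K] (p : W → X → Prop) (hp : ∀ w, ∀ᵐ x ∂PX, p w x) :
    ∀ᵐ ω ∂(Measure.infinitePi fun _ : W => indexedLaw PX K), ∀ w, p w (ω w).1 := by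
  refine ae_all_iff.2 fun w => ?_
  have h := (measurePreserving_eval_infinitePi (fun _ : W => indexedLaw PX K)
    w).quasiMeasurePreserving
  exact h.ae (p := fun e : X × Fin K => p w e.1)
    (Measure.quasiMeasurePreserving_fst.ae (hp w))

open Classical in
/-- Random coding: if the likelihoods `b w x o` of the codewords have total mean at most one, some
codebook with assigned decoder indices and measurable maximum-likelihood decoders has error mass
at most the expectation of `b m / (b + m)`, where `m = 1 / K`. -/
theorem exists_codebook [MeasurableSpace W] [Countable W] [MeasurableSingletonClass W] [Nonempty W] (K : ℕ) [NeZero K]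
    (PX : Measure X) [IsProbabilityMeasure PX] (ν : Measure O) [SFinite ν]
    (b : W → X → O → ℝ≥0) (hb : ∀ w, Measurable fun p : X × O => b w p.1 p.2)
    (hsum : ∀ᵐ o ∂ν, ∑' w, ∫⁻ x, b w x o ∂PX ≤ 1)
    (p : W → X → Prop) (hp : ∀ w, ∀ᵐ x ∂PX, p w x) :
    ∃ (x : W → X) (J : W → Fin K) (dec : Fin K → O → W), (∀ k, Measurable (dec k)) ∧
      (∀ w, p w (x w)) ∧
      ∑' w, ∫⁻ o, (if w = dec (J w) o then 0 else (b w (x w) o : ℝ≥0∞)) ∂ν ≤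
        ∑' w, ∫⁻ x, ∫⁻ o, (b w x o * ((K : ℝ≥0)⁻¹ / (b w x o + (K : ℝ≥0)⁻¹)) : ℝ≥0) ∂ν ∂PX := by
  set m : ℝ≥0 := (K : ℝ≥0)⁻¹ with hm_def
  have hK : (K : ℝ≥0) ≠ 0 := by exact_mod_cast NeZero.ne K
  have hm : 0 < m := by positivity
  have hmK : (m : ℝ≥0∞) = (K : ℝ≥0∞)⁻¹ := by
    rw [hm_def, ENNReal.coe_inv hK, ENNReal.coe_natCast]
  -- Decoder `k` gives weight zero to symbols assigned to another decoder.
  let β : Fin K → O → W → X × Fin K → ℝ≥0 := fun k o w e => if e.2 = k then b w e.1 o else 0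
  have hβ : ∀ k w, Measurable fun q : (X × Fin K) × O => β k q.2 w q.1 := fun k w =>
    Measurable.ite (measurableSet_eq_fun (by fun_prop) measurable_const)
      ((hb w).comp (by fun_prop : Measurable fun q : (X × Fin K) × O => (q.1.1, q.2)))
      measurable_const
  let G : (W → X × Fin K) → ℝ≥0∞ := fun ω =>
    ∑ k, ∫⁻ o, tangentBound m (fun w => β k o w (ω w)) ∂ν
  have hT : ∀ k, Measurable fun q : (W → X × Fin K) × O =>
      tangentBound m (fun w => β k q.2 w (q.1 w)) := fun k =>
    measurable_tangentBound m fun w => (hβ k w).comp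
      (by fun_prop : Measurable fun q : (W → X × Fin K) × O => (q.1 w, q.2))
  have hG : Measurable G := Finset.measurable_fun_sum _ fun k _ => (hT k).lintegral_prod_right'
  have hmul : ∀ w, Measurable fun q : X × O => ((b w q.1 q.2 * (m / (b w q.1 q.2 + m)) : ℝ≥0) :
      ℝ≥0∞) := fun w => by have := hb w; fun_prop
  have hbX : ∀ w o, Measurable fun x => b w x o := fun w o =>
    (hb w).comp measurable_prodMk_right
  have hEG : ∫⁻ ω, G ω ∂(Measure.infinitePi fun _ : W => indexedLaw PX K) ≤
      ∑' w, ∫⁻ x, ∫⁻ o, (b w x o * (m / (b w x o + m)) : ℝ≥0) ∂ν ∂PX := by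
    -- The random index brings the total mean likelihood below `m`, and also puts a factor `m` in
    -- front of the bound, which the sum over the `K` decoders cancels.
    have hk : ∀ k, ∫⁻ ω, ∫⁻ o, tangentBound m (fun w => β k o w (ω w)) ∂ν
        ∂(Measure.infinitePi fun _ : W => indexedLaw PX K) ≤
        m * ∑' w, ∫⁻ x, ∫⁻ o, (b w x o * (m / (b w x o + m)) : ℝ≥0) ∂ν ∂PX := fun k => by
      rw [lintegral_lintegral_swap (hT k).aemeasurable]
      have hle : ∀ᵐ o ∂ν, ∫⁻ ω, tangentBound m (fun w => β k o w (ω w))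
          ∂(Measure.infinitePi fun _ : W => indexedLaw PX K) ≤
          ∑' w, (m : ℝ≥0∞) * ∫⁻ x, (b w x o * (m / (b w x o + m)) : ℝ≥0) ∂PX := by
        filter_upwards [hsum] with o ho
        refine (lintegral_tangentBound_le (indexedLaw PX K) (β k o)
          (fun w => (hβ k w).comp measurable_prodMk_right) m hm ?_).trans (le_of_eq ?_)
        · calc ∑' w, ∫⁻ e, β k o w e ∂(indexedLaw PX K)
              = ∑' w, (K : ℝ≥0∞)⁻¹ * ∫⁻ x, b w x o ∂PX := by
                refine tsum_congr fun w => ?_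
                rw [← lintegral_indexedLaw PX K k (hbX w o).coe_nnreal_ennreal]
                refine lintegral_congr fun e => ?_
                simp only [β]
                split_ifs <;> simp
            _ ≤ m := by
                rw [ENNReal.tsum_mul_left, hmK]
                exact mul_le_of_le_one_right' ho
        · refine tsum_congr fun w => ?_
          have hx : Measurable fun x => ((b w x o * (m / (b w x o + m)) : ℝ≥0) : ℝ≥0∞) :=
            (hmul w).comp measurable_prodMk_right
          rw [hmK, ← lintegral_indexedLaw PX K k hx]
          refine lintegral_congr fun e => ?_
          simp only [β]
          split_ifs <;> simp
      refine (lintegral_mono_ae hle).trans (le_of_eq ?_)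
      rw [lintegral_tsum fun w => ((hmul w).lintegral_prod_left').const_mul _ |>.aemeasurable,
        ← ENNReal.tsum_mul_left]
      refine tsum_congr fun w => ?_
      rw [lintegral_const_mul _ (hmul w).lintegral_prod_left',
        lintegral_lintegral_swap (f := fun x o => ((b w x o * (m / (b w x o + m)) : ℝ≥0) : ℝ≥0∞))
          (hmul w).aemeasurable]
    rw [lintegral_finsetSum _ fun k _ => (hT k).lintegral_prod_right']
    refine (Finset.sum_le_sum fun k _ => hk k).trans (le_of_eq ?_)
    rw [Finset.sum_const, Finset.card_univ, Fintype.card_fin, nsmul_eq_mul, ← mul_assoc, hmK,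
      ENNReal.mul_inv_cancel (by exact_mod_cast NeZero.ne K) (ENNReal.natCast_ne_top K), one_mul]
  -- Some codebook does at least as well as the mean while avoiding the null set where `p` fails.
  obtain ⟨ω, hω, hGω⟩ := exists_notMem_null_le_lintegral hG.aemeasurable
    (ae_iff.1 (ae_infinitePi_indexedLaw PX K p hp))
  have hc : ∀ k w, Measurable fun o => β k o w (ω w) := fun k w =>
    (hβ k w).comp measurable_prodMk_left
  choose dec hdec hmax using fun k => exists_measurable_argmax (fun w o => β k o w (ω w)) (hc k)
  refine ⟨fun w => (ω w).1, fun w => (ω w).2, dec, hdec, not_not.1 hω, le_trans ?_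
    (hGω.trans hEG)⟩
  have hterm : ∀ k w, Measurable fun o =>
      if w = dec k o then 0 else (β k o w (ω w) : ℝ≥0∞) := fun k w =>
    Measurable.ite (measurableSet_eq_fun measurable_const (hdec k)) measurable_const
      (hc k w).coe_nnreal_ennreal

  calc ∑' w, ∫⁻ o, (if w = dec (ω w).2 o then 0 else (b w (ω w).1 o : ℝ≥0∞)) ∂ν
      ≤ ∑' w, ∑ k, ∫⁻ o, (if w = dec k o then 0 else (β k o w (ω w) : ℝ≥0∞)) ∂ν := by
        refine ENNReal.tsum_le_tsum fun w => ?_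
        refine le_trans (le_of_eq ?_) (Finset.single_le_sum (fun _ _ => zero_le)
          (Finset.mem_univ (ω w).2))
        simp [β]
    _ = ∑ k, ∫⁻ o, (∑' w, if w = dec k o then 0 else (β k o w (ω w) : ℝ≥0∞)) ∂ν := by
        rw [Summable.tsum_finsetSum fun _ _ => ENNReal.summable]
        refine Finset.sum_congr rfl fun k _ => ?_
        rw [lintegral_tsum fun w => (hterm k w).aemeasurable]
    _ ≤ G ω := Finset.sum_le_sum fun k _ => lintegral_mono fun o =>
        tsum_ne_argmax_le (fun w => β k o w (ω w)) m hm (dec k o) (hmax k o)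

end Codebook
-- Information density as a Radon–Nikodym derivative
section Density

variable {X Y : Type*} [MeasurableSpace X] [MeasurableSpace Y]

lemma fst_absolutelyContinuous {θX : Measure X} {θY : Measure Y} [SFinite θY]
    {P : Measure (X × Y)} (h : P ≪ θX.prod θY) : P.fst ≪ θX := by
  refine Measure.AbsolutelyContinuous.mk fun s hs h0 => ?_
  rw [Measure.fst_apply hs]
  refine h ?_
  rw [← Set.prod_univ, Measure.prod_prod, h0, zero_mul]

lemma snd_absolutelyContinuous {θX : Measure X} {θY : Measure Y} [SFinite θY]
    {P : Measure (X × Y)} (h : P ≪ θX.prod θY) : P.snd ≪ θY := by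
  refine Measure.AbsolutelyContinuous.mk fun s hs h0 => ?_
  rw [Measure.snd_apply hs]
  refine h ?_
  rw [← Set.univ_prod, Measure.prod_prod, h0, mul_zero]

variable (θX : Measure X) [SigmaFinite θX] (θY : Measure Y) [SigmaFinite θY]
  (P : Measure (X × Y)) [IsProbabilityMeasure P]

lemma fst_prod_snd_eq_withDensity (h : P ≪ θX.prod θY) :
    P.fst.prod P.snd = (θX.prod θY).withDensity
      fun p => P.fst.rnDeriv θX p.1 * P.snd.rnDeriv θY p.2 := by
  rw [← prod_withDensity (Measure.measurable_rnDeriv _ _) (Measure.measurable_rnDeriv _ _),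
    Measure.withDensity_rnDeriv_eq _ _ (fst_absolutelyContinuous h),
    Measure.withDensity_rnDeriv_eq _ _ (snd_absolutelyContinuous h)]

/-- Where both marginal densities are nonzero, null sets of the product of marginals are null for
`θX.prod θY`; elsewhere `P` has no mass. -/
lemma absolutelyContinuous_fst_prod_snd (h : P ≪ θX.prod θY) : P ≪ P.fst.prod P.snd := by
  have hX := fst_absolutelyContinuous h
  have hY := snd_absolutelyContinuous h
  have hpos : ∀ᵐ p ∂P, P.fst.rnDeriv θX p.1 * P.snd.rnDeriv θY p.2 ≠ 0 := by
    have h1 : ∀ᵐ p ∂P, 0 < P.fst.rnDeriv θX p.1 :=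
      ae_of_ae_map measurable_fst.aemeasurable (Measure.rnDeriv_pos hX)
    have h2 : ∀ᵐ p ∂P, 0 < P.snd.rnDeriv θY p.2 :=
      ae_of_ae_map measurable_snd.aemeasurable (Measure.rnDeriv_pos hY)
    filter_upwards [h1, h2] with p h1 h2 using mul_ne_zero h1.ne' h2.ne'
  have hprod := fst_prod_snd_eq_withDensity θX θY P h
  refine Measure.AbsolutelyContinuous.mk fun s hs h0 => ?_
  have hmeas : Measurable fun p : X × Y => P.fst.rnDeriv θX p.1 * P.snd.rnDeriv θY p.2 := by
    fun_prop
  rw [hprod, withDensity_apply_eq_zero hmeas] at h0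
  have h1 := h h0
  refine measure_mono_null (t := _ ∪ {p | ¬ (P.fst.rnDeriv θX p.1 * P.snd.rnDeriv θY p.2 ≠ 0)})
    (fun p hp => ?_) (measure_union_null h1 (ae_iff.1 hpos))
  by_cases hz : P.fst.rnDeriv θX p.1 * P.snd.rnDeriv θY p.2 = 0
  · exact Or.inr (not_not.2 hz)
  · exact Or.inl ⟨hz, hp⟩

/-- The information density is the logarithm of the density with respect to the product of the
marginals. -/
lemma two_rpow_infoDensity_ae_eq (h : P ≪ θX.prod θY) :
    ∀ᵐ p ∂P, (2 : ℝ) ^ infoDensity θX θY P p.1 p.2 =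
      (P.rnDeriv (P.fst.prod P.snd) p).toReal := by
  have hX := fst_absolutelyContinuous h
  have hY := snd_absolutelyContinuous h
  have hac := absolutelyContinuous_fst_prod_snd θX θY P h
  have hprod := fst_prod_snd_eq_withDensity θX θY P h
  have hmeas : Measurable fun p : X × Y => P.fst.rnDeriv θX p.1 * P.snd.rnDeriv θY p.2 := by
    fun_prop
  have hden : (P.fst.prod P.snd).rnDeriv (θX.prod θY) =ᵐ[θX.prod θY]
      fun p => P.fst.rnDeriv θX p.1 * P.snd.rnDeriv θY p.2 := by
    conv_lhs => rw [hprod]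
    exact Measure.rnDeriv_withDensity _ hmeas
  have h1 : ∀ᵐ p ∂P, 0 < P.fst.rnDeriv θX p.1 :=
    ae_of_ae_map measurable_fst.aemeasurable (Measure.rnDeriv_pos hX)
  have h2 : ∀ᵐ p ∂P, 0 < P.snd.rnDeriv θY p.2 :=
    ae_of_ae_map measurable_snd.aemeasurable (Measure.rnDeriv_pos hY)
  have h3 : ∀ᵐ p ∂P, P.fst.rnDeriv θX p.1 < ∞ :=
    ae_of_ae_map measurable_fst.aemeasurable (hX.ae_le (Measure.rnDeriv_lt_top P.fst θX))
  have h4 : ∀ᵐ p ∂P, P.snd.rnDeriv θY p.2 < ∞ :=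
    ae_of_ae_map measurable_snd.aemeasurable (hY.ae_le (Measure.rnDeriv_lt_top P.snd θY))
  filter_upwards [h1, h2, h3, h4, h.ae_le (Measure.rnDeriv_mul_rnDeriv (κ := θX.prod θY) hac),
    h.ae_le hden, Measure.rnDeriv_pos hac, hac.ae_le (Measure.rnDeriv_lt_top P (P.fst.prod P.snd))]
    with p h1 h2 h3 h4 h5 h6 h7 h8
  rw [infoDensity, ← h5, Pi.mul_apply, h6, ENNReal.toReal_mul, ENNReal.toReal_mul,
    mul_div_assoc, div_self, mul_one, Real.rpow_logb (by norm_num) (by norm_num)]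
  · exact ENNReal.toReal_pos h7.ne' h8.ne
  · exact (mul_pos (ENNReal.toReal_pos h1.ne' h3.ne) (ENNReal.toReal_pos h2.ne' h4.ne)).ne'

end Density

/-! ### Channel density with respect to the output law -/

section Channel

variable {X Y : Type*} [MeasurableSpace X] [MeasurableSpace Y]
  [MeasurableSpace.CountableOrCountablyGenerated X Y]

/-- A channel whose joint law is absolutely continuous has a jointly measurable finite density with
respect to the output law. -/
lemma exists_channel_density (PX : Measure X) [IsProbabilityMeasure PX] (PYX : Kernel X Y)
    [IsMarkovKernel PYX] (hac : PX ⊗ₘ PYX ≪ PX.prod (PX ⊗ₘ PYX).snd) :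
    ∃ r : X → Y → ℝ≥0, (Measurable fun p : X × Y => r p.1 p.2) ∧
      (∀ᵐ x ∂PX, PYX x = (PX ⊗ₘ PYX).snd.withDensity fun y => (r x y : ℝ≥0∞)) ∧
      (∀ᵐ y ∂(PX ⊗ₘ PYX).snd, ∫⁻ x, r x y ∂PX ≤ 1) ∧
      ∀ᵐ p ∂(PX ⊗ₘ PYX), ((PX ⊗ₘ PYX).rnDeriv (PX.prod (PX ⊗ₘ PYX).snd) p).toReal = r p.1 p.2 := by
  set PY := (PX ⊗ₘ PYX).snd with hPY
  let η : Kernel X Y := Kernel.const X PY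
  have hη : PX ⊗ₘ η = PX.prod PY := Measure.compProd_const
  have hxac : ∀ᵐ x ∂PX, PYX x ≪ η x := (hη ▸ hac : PX ⊗ₘ PYX ≪ PX ⊗ₘ η).kernel_of_compProd
  have hr : Measurable fun p : X × Y => (PYX.rnDeriv η p.1 p.2).toNNReal :=
    (Kernel.measurable_rnDeriv PYX η).ennreal_toNNReal
  have hdens : ∀ᵐ x ∂PX, PYX x =
      PY.withDensity fun y => ((PYX.rnDeriv η x y).toNNReal : ℝ≥0∞) := by
    filter_upwards [hxac] with x hx
    conv_lhs => rw [← Kernel.withDensity_rnDeriv_eq hx]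
    rw [Kernel.withDensity_apply _ (Kernel.measurable_rnDeriv PYX η)]
    refine withDensity_congr_ae ?_
    filter_upwards [Kernel.rnDeriv_ne_top PYX η (a := x)] with y hy
    exact (ENNReal.coe_toNNReal hy).symm
  have hjoint : PX ⊗ₘ PYX = (PX.prod PY).withDensity
      fun p => ((PYX.rnDeriv η p.1 p.2).toNNReal : ℝ≥0∞) := by
    ext s hs
    rw [withDensity_apply _ hs, Measure.compProd_apply hs, ← lintegral_indicator hs,
      lintegral_prod _ (hr.coe_nnreal_ennreal.indicator hs).aemeasurable]
    refine lintegral_congr_ae ?_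
    filter_upwards [hdens] with x hx
    rw [hx, withDensity_apply _ (measurable_prodMk_left hs),
      ← lintegral_indicator (measurable_prodMk_left hs)]
    rfl
  refine ⟨fun x y => (PYX.rnDeriv η x y).toNNReal, hr, hdens, ?_, ?_⟩
  · have hmeas : Measurable fun y => ∫⁻ x, ((PYX.rnDeriv η x y).toNNReal : ℝ≥0∞) ∂PX :=
      hr.coe_nnreal_ennreal.lintegral_prod_left'
    -- Integrating the `x`-average of the density over `s` against `PY` gives back `PY s`.
    refine ae_le_of_forall_setLIntegral_le_of_sigmaFinite hmeas fun s hs _ => ?_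
    have h1 : PY s = ∫⁻ y in s, ∫⁻ x, ((PYX.rnDeriv η x y).toNNReal : ℝ≥0∞) ∂PX ∂PY := by
      conv_lhs => rw [hPY, Measure.snd_apply hs, hjoint,
        withDensity_apply _ (measurable_snd hs), ← Set.univ_prod]
      rw [setLIntegral_prod_symm _ hr.coe_nnreal_ennreal.aemeasurable]
      simp
    rw [← h1]
    simp
  · have h1 := Measure.rnDeriv_withDensity (PX.prod PY) hr.coe_nnreal_ennreal
    rw [← hjoint] at h1
    filter_upwards [hac.ae_le h1] with p hp
    rw [hp]; rfl

end Channel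
-- From codebooks to codes
section Coding

variable {W X O : Type*} [MeasurableSpace W] [Countable W] [DiscreteMeasurableSpace W]
  [MeasurableSpace X] [MeasurableSpace O] {K : ℕ}

/-- The probability that all decoders fail is at most the probability that a decoder designated
by the source symbol fails. -/
lemma compProd_iidKernel_forall_ne_le (PW : Measure W) [IsProbabilityMeasure PW] (κ : Kernel W O)
    [IsMarkovKernel κ] (dec : Fin K → O → W) (hdec : ∀ k, Measurable (dec k)) (J : W → Fin K) :
    (PW ⊗ₘ iidKernel K κ) {p | ∀ k, 0 < hammingDistortion p.1 (dec k (p.2 k))} ≤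
      ∑' w, PW {w} * κ w {o | w ≠ dec (J w) o} := by
  have hset : ∀ w, MeasurableSet {o | w ≠ dec (J w) o} := fun w =>
    (measurableSet_eq_fun measurable_const (hdec (J w))).compl
  have hB : MeasurableSet {p : W × (Fin K → O) | p.1 ≠ dec (J p.1) (p.2 (J p.1))} := by
    have : Measurable fun p : W × (Fin K → O) => dec (J p.1) (p.2 (J p.1)) :=
      measurable_from_prod_countable_right fun w => (hdec (J w)).comp (measurable_pi_apply (J w))
    exact (measurableSet_eq_fun measurable_fst this).compl
  calc (PW ⊗ₘ iidKernel K κ) {p | ∀ k, 0 < hammingDistortion p.1 (dec k (p.2 k))}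
      ≤ (PW ⊗ₘ iidKernel K κ) {p | p.1 ≠ dec (J p.1) (p.2 (J p.1))} := by
        refine measure_mono fun p hp h => ?_
        have := hp (J p.1)
        simp [hammingDistortion, ← h] at this
    _ = ∑' w, PW {w} * κ w {o | w ≠ dec (J w) o} := by
        rw [Measure.compProd_apply hB, lintegral_countable']
        refine tsum_congr fun w => ?_
        rw [mul_comm]
        congr 1
        -- Only the marginal of coordinate `J w` matters, and it is `κ w`.
        exact (measurePreserving_eval (fun _ : Fin K => κ w) (J w)).measure_preimage
          (hset w).nullMeasurableSet

/-- Change of measure: `b * K⁻¹ / (b + K⁻¹) = b / (1 + K * b)`, and the factor `b` turns `ν` into `a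
• Q`. -/
lemma smul_lintegral_eq_of_withDensity {ν Q : Measure O} {a : ℝ≥0∞} {b : O → ℝ≥0}
    (hb : Measurable b) (h : a • Q = ν.withDensity fun o => (b o : ℝ≥0∞)) (hK : (K : ℝ≥0) ≠ 0) :
    ∫⁻ o, (b o * ((K : ℝ≥0)⁻¹ / (b o + (K : ℝ≥0)⁻¹)) : ℝ≥0) ∂ν =
      a * ∫⁻ o, ((1 + K * b o)⁻¹ : ℝ≥0) ∂Q := by
  rw [← smul_eq_mul, ← lintegral_smul_measure, h, lintegral_withDensity_eq_lintegral_mul _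
    hb.coe_nnreal_ennreal (by fun_prop)]
  refine lintegral_congr fun o => ?_
  simp only [Pi.mul_apply]
  norm_cast
  have h1 : b o + (K : ℝ≥0)⁻¹ ≠ 0 := by positivity
  have h2 : 1 + K * b o ≠ 0 := by positivity
  field_simp
  ring

lemma tsum_measure_singleton_eq_one (PW : Measure W) [IsProbabilityMeasure PW] :
    ∑' w, PW {w} = 1 := by
  have := lintegral_countable' (μ := PW) (fun _ => 1)
  simpa using this.symm

/-- Achievability for a general observation whose law given the source symbol `w` and the codeword
`x` has, after weighting by the source probability, the likelihood `b w x`. -/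
theorem exists_code [Nonempty W] (PW : Measure W) [IsProbabilityMeasure PW] (PX : Measure X)
    [IsProbabilityMeasure PX] (ν : Measure O) [SFinite ν] (Q : W → X → Measure O)
    [∀ w x, IsProbabilityMeasure (Q w x)] (b : W → X → O → ℝ≥0)
    (hb : ∀ w, Measurable fun p : X × O => b w p.1 p.2)
    (hsum : ∀ᵐ o ∂ν, ∑' w, ∫⁻ x, b w x o ∂PX ≤ 1)
    (hQ : ∀ w, ∀ᵐ x ∂PX, PW {w} • Q w x = ν.withDensity fun o => (b w x o : ℝ≥0∞)) :
    ∃ c : Code W X O W K, ∀ (κ : Kernel W O) [IsMarkovKernel κ], (∀ w, κ w = Q w (c.enc w)) →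
      (PW ⊗ₘ iidKernel K κ) {p | ∀ k, 0 < hammingDistortion p.1 (c.dec k (p.2 k))} ≤
        ∑' w, PW {w} * ∫⁻ x, ∫⁻ o, ((1 + K * b w x o)⁻¹ : ℝ≥0) ∂(Q w x) ∂PX := by
  classical
  -- Without decoders the bound is 1, and any encoder will do.
  rcases eq_or_ne K 0 with rfl | hK0
  · have : Nonempty X := PX.nonempty_of_neZero
    refine ⟨⟨fun _ => Classical.arbitrary X, measurable_const, fun k => k.elim0,
      fun k => k.elim0⟩, fun κ _ _ => prob_le_one.trans ?_⟩
    simp [tsum_measure_singleton_eq_one]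
  have : NeZero K := ⟨hK0⟩
  have hK : (K : ℝ≥0) ≠ 0 := by exact_mod_cast hK0
  obtain ⟨x, J, dec, hdec, hx, hle⟩ := exists_codebook K PX ν b hb hsum _ hQ
  refine ⟨⟨x, measurable_of_countable x, dec, hdec⟩, fun κ _ hκ =>
    (compProd_iidKernel_forall_ne_le PW κ dec hdec J).trans ((le_of_eq ?_).trans
      (hle.trans (le_of_eq ?_)))⟩
  · refine tsum_congr fun w => ?_
    have hs : MeasurableSet {o | w ≠ dec (J w) o} :=
      (measurableSet_eq_fun measurable_const (hdec (J w))).compl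
    rw [hκ w, ← smul_eq_mul, ← Measure.smul_apply, hx w, withDensity_apply _ hs,
      ← lintegral_indicator hs]
    refine lintegral_congr fun o => ?_
    by_cases h : w = dec (J w) o
    · rw [if_pos h, Set.indicator_of_notMem (by simpa using h)]
    · rw [if_neg h, Set.indicator_of_mem (by exact h)]
  · refine tsum_congr fun w => ?_
    rw [← lintegral_const_mul' _ _ (measure_ne_top _ _)]
    refine lintegral_congr_ae ?_
    filter_upwards [hQ w] with x hx
    exact smul_lintegral_eq_of_withDensity ((hb w).comp measurable_prodMk_left) hx hK

end Coding

/-! ### Real-valued bounds and Bayes' rule -/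

section RealBounds

lemma measureReal_le_integral {A B : Type*} [MeasurableSpace A] [MeasurableSpace B]
    {μ : Measure A} {ρ : Measure B} [IsProbabilityMeasure ρ] {s : Set A} {h : B → ℝ≥0}
    (hm : Measurable h) (h1 : ∀ p, h p ≤ 1) {f : B → ℝ} (hf : ∀ᵐ p ∂ρ, f p = h p)
    (hle : μ s ≤ ∫⁻ p, h p ∂ρ) : μ.real s ≤ ∫ p, f p ∂ρ := by
  have hfin : ∫⁻ p, h p ∂ρ ≠ ∞ := by
    refine ne_top_of_le_ne_top ENNReal.one_ne_top ?_
    calc ∫⁻ p, h p ∂ρ ≤ ∫⁻ _, 1 ∂ρ := lintegral_mono fun p => ENNReal.coe_le_one_iff.2 (h1 p)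
      _ = 1 := by simp
  rw [integral_congr_ae hf, integral_eq_lintegral_of_nonneg_ae (by simp [Filter.EventuallyLE])
    hm.coe_nnreal_real.aestronglyMeasurable]
  simp only [ENNReal.ofReal_coe_nnreal]
  exact ENNReal.toReal_mono hfin hle

lemma lintegral_lintegral_prod_eq {X Y T : Type*} [MeasurableSpace X] [MeasurableSpace Y]
    [MeasurableSpace T] (PX : Measure X) [SFinite PX] (PYX : Kernel X Y) [IsSFiniteKernel PYX]
    (τ : Measure T) [SFinite τ] {F : T × X × Y → ℝ≥0∞} (hF : Measurable F) :
    ∫⁻ x, ∫⁻ o, F (o.2, x, o.1) ∂((PYX x).prod τ) ∂PX =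
      ∫⁻ t, ∫⁻ q, F (t, q) ∂(PX ⊗ₘ PYX) ∂τ := by
  have hx : ∀ x, ∫⁻ o, F (o.2, x, o.1) ∂((PYX x).prod τ) =
      ∫⁻ y, ∫⁻ t, F (t, x, y) ∂τ ∂(PYX x) := fun x => by
    have h : Measurable fun o : Y × T => F (o.2, x, o.1) :=
      hF.comp (by fun_prop : Measurable fun o : Y × T => (o.2, x, o.1))
    rw [lintegral_prod _ h.aemeasurable]
  simp_rw [hx]
  rw [← Measure.lintegral_compProd (f := fun q => ∫⁻ t, F (t, q) ∂τ) hF.lintegral_prod_left']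
  exact lintegral_lintegral_swap (f := fun q t => F (t, q))
    (hF.comp measurable_swap).aemeasurable

/-- Bayes' rule: on a set `s`, both sides give the joint mass of `{w} ×ˢ s`. This makes the
posterior the source weight of a decoder with side information. -/
lemma smul_eq_withDensity_posterior {W T : Type*} [MeasurableSpace W] [Countable W]
    [DiscreteMeasurableSpace W] [Nonempty W] [MeasurableSpace T] (PW : Measure W)
    [IsProbabilityMeasure PW] (PTW : Kernel W T) [IsMarkovKernel PTW] (w : W) :
    PW {w} • PTW w = (PTW ∘ₘ PW).withDensity fun t => posterior PTW PW t {w} := by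
  ext s hs
  rw [withDensity_apply _ hs, ← Measure.compProd_apply_prod hs (measurableSet_singleton w),
    compProd_posterior_eq_map_swap, Measure.map_apply measurable_swap
      (hs.prod (measurableSet_singleton w)), Set.preimage_swap_prod,
    Measure.compProd_apply_prod (measurableSet_singleton w) hs, lintegral_singleton]
  simp [mul_comm]

end RealBounds

/-! ### The two achievability bounds -/

section Main

variable {W X Y T : Type*}
  [MeasurableSpace W] [Countable W] [DiscreteMeasurableSpace W] [Nonempty W]
  [MeasurableSpace X] [MeasurableSpace Y] [MeasurableSpace T]

theorem exists_code_errorProb_le (K : ℕ) (PW : Measure W) [IsProbabilityMeasure PW]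
    (PX : Measure X) [IsProbabilityMeasure PX] (PYX : Kernel X Y) [IsMarkovKernel PYX]
    {r : X → Y → ℝ≥0} (hr : Measurable fun p : X × Y => r p.1 p.2)
    (hdens : ∀ᵐ x ∂PX, PYX x = (PX ⊗ₘ PYX).snd.withDensity fun y => (r x y : ℝ≥0∞))
    (hle1 : ∀ᵐ y ∂(PX ⊗ₘ PYX).snd, ∫⁻ x, r x y ∂PX ≤ 1)
    {ι : X → Y → ℝ} (hιr : ∀ᵐ p ∂(PX ⊗ₘ PYX), (2 : ℝ) ^ ι p.1 p.2 = r p.1 p.2) :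
    ∃ c : Code W X Y W K, c.errorProb PW PYX hammingDistortion 0 ≤
      ∫ p, (1 + (K : ℝ) * PW.real {p.1} * (2 : ℝ) ^ ι p.2.1 p.2.2)⁻¹
        ∂(PW.prod (PX ⊗ₘ PYX)) := by
  have hinv : ∀ a : ℝ≥0, (1 + a)⁻¹ ≤ 1 := fun a => inv_le_one_of_one_le₀ le_self_add
  obtain ⟨c, hc⟩ := exists_code (K := K) PW PX (PX ⊗ₘ PYX).snd (fun _ x => PYX x)
    (fun w x y => (PW {w}).toNNReal * r x y) (fun w => measurable_const.mul hr)
    (by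
      filter_upwards [hle1] with y hy
      have hm : Measurable fun x => (r x y : ℝ≥0∞) :=
        (hr.comp measurable_prodMk_right).coe_nnreal_ennreal
      simp only [ENNReal.coe_mul, ENNReal.coe_toNNReal (measure_ne_top PW _)]
      simp_rw [lintegral_const_mul _ hm]
      rwa [ENNReal.tsum_mul_right, tsum_measure_singleton_eq_one, one_mul])
    (fun w => by
      filter_upwards [hdens] with x hx
      have hm : Measurable fun y => (r x y : ℝ≥0∞) :=
        (hr.comp measurable_prodMk_left).coe_nnreal_ennreal
      simp only [ENNReal.coe_mul, ENNReal.coe_toNNReal (measure_ne_top PW _)]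
      conv_lhs => rw [hx]
      rw [← withDensity_smul _ hm]
      rfl)
  refine ⟨c, ?_⟩
  have hm : Measurable fun p : W × X × Y =>
      (1 + K * ((PW {p.1}).toNNReal * r p.2.1 p.2.2))⁻¹ := by
    have h1 : Measurable fun p : W × X × Y => (PW {p.1}).toNNReal :=
      (measurable_of_countable fun w => (PW {w}).toNNReal).comp measurable_fst
    have h2 : Measurable fun p : W × X × Y => r p.2.1 p.2.2 := hr.comp measurable_snd
    fun_prop
  refine measureReal_le_integral hm (fun p => hinv _) ?_
    ((hc (PYX.comap c.enc c.measurable_enc) fun w => rfl).trans (le_of_eq ?_))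
  · filter_upwards [Measure.quasiMeasurePreserving_snd.ae hιr] with p hp
    rw [hp]
    push_cast
    rw [← mul_assoc]
    rfl
  · rw [lintegral_prod _ hm.coe_nnreal_ennreal.aemeasurable, lintegral_countable']
    refine tsum_congr fun w => ?_
    have hmw : Measurable fun q : X × Y =>
        ((((1 + K * ((PW {w}).toNNReal * r q.1 q.2))⁻¹ : ℝ≥0)) : ℝ≥0∞) :=
      by fun_prop
    rw [Measure.lintegral_compProd hmw, mul_comm]

theorem exists_code_errorProbSI_le (K : ℕ) (PW : Measure W) [IsProbabilityMeasure PW]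
    (PX : Measure X) [IsProbabilityMeasure PX] (PYX : Kernel X Y) [IsMarkovKernel PYX]
    (PTW : Kernel W T) [IsMarkovKernel PTW]
    {r : X → Y → ℝ≥0} (hr : Measurable fun p : X × Y => r p.1 p.2)
    (hdens : ∀ᵐ x ∂PX, PYX x = (PX ⊗ₘ PYX).snd.withDensity fun y => (r x y : ℝ≥0∞))
    (hle1 : ∀ᵐ y ∂(PX ⊗ₘ PYX).snd, ∫⁻ x, r x y ∂PX ≤ 1)
    {ι : X → Y → ℝ} (hιr : ∀ᵐ p ∂(PX ⊗ₘ PYX), (2 : ℝ) ^ ι p.1 p.2 = r p.1 p.2) :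
    ∃ c : Code W X (Y × T) W K, c.errorProbSI PW PYX PTW hammingDistortion 0 ≤
      ∫ p, (1 + (K : ℝ) * (posterior PTW PW p.1.2).real {p.1.1} * (2 : ℝ) ^ ι p.2.1 p.2.2)⁻¹
        ∂((PW ⊗ₘ PTW).prod (PX ⊗ₘ PYX)) := by
  have hinv : ∀ a : ℝ≥0, (1 + a)⁻¹ ≤ 1 := fun a => inv_le_one_of_one_le₀ le_self_add
  have hpost : ∀ w, Measurable fun t => (posterior PTW PW t {w}).toNNReal := fun w =>
    (Kernel.measurable_coe _ (measurableSet_singleton w)).ennreal_toNNReal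
  obtain ⟨c, hc⟩ := exists_code (K := K) PW PX ((PX ⊗ₘ PYX).snd.prod (PTW ∘ₘ PW))
    -- The reference measure is the product of the output law and the law of `T`; the likelihood
    -- weights sum to at most one because the posterior is a probability measure.
    (fun w x => (PYX x).prod (PTW w))
    (fun w x o => (posterior PTW PW o.2 {w}).toNNReal * r x o.1)
    (fun w => ((hpost w).comp (measurable_snd.comp measurable_snd)).mul
      (hr.comp (by fun_prop : Measurable fun p : X × Y × T => (p.1, p.2.1))))
    (by
      filter_upwards [Measure.quasiMeasurePreserving_fst.ae hle1] with o ho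
      have hm : Measurable fun x => (r x o.1 : ℝ≥0∞) :=
        (hr.comp measurable_prodMk_right).coe_nnreal_ennreal
      simp only [ENNReal.coe_mul, ENNReal.coe_toNNReal (measure_ne_top _ _)]
      simp_rw [lintegral_const_mul _ hm]
      rwa [ENNReal.tsum_mul_right, tsum_measure_singleton_eq_one, one_mul])
    (fun w => by
      filter_upwards [hdens] with x hx
      have hm : Measurable fun y => (r x y : ℝ≥0∞) :=
        (hr.comp measurable_prodMk_left).coe_nnreal_ennreal
      simp only [ENNReal.coe_mul, ENNReal.coe_toNNReal (measure_ne_top _ _)]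
      rw [← Measure.prod_smul_right, smul_eq_withDensity_posterior]
      conv_lhs => rw [hx]
      rw [prod_withDensity hm (Kernel.measurable_coe _ (measurableSet_singleton w))]
      simp only [mul_comm])
  have hm : Measurable fun p : (W × T) × X × Y =>
      (1 + K * ((posterior PTW PW p.1.2 {p.1.1}).toNNReal * r p.2.1 p.2.2))⁻¹ := by
    have h1 : Measurable fun q : W × T => (posterior PTW PW q.2 {q.1}).toNNReal :=
      measurable_from_prod_countable_right hpost
    have h2 : Measurable fun p : (W × T) × X × Y => r p.2.1 p.2.2 := hr.comp measurable_snd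
    have h3 := h1.comp (measurable_fst : Measurable (Prod.fst : (W × T) × X × Y → W × T))
    simp only [Function.comp_def] at h3
    fun_prop
  refine ⟨c, measureReal_le_integral hm (fun p => hinv _) ?_
    ((hc ((PYX.comap c.enc c.measurable_enc) ×ₖ PTW) fun w => ?_).trans (le_of_eq ?_))⟩
  · filter_upwards [Measure.quasiMeasurePreserving_snd.ae hιr] with p hp
    rw [hp]
    push_cast
    rw [← mul_assoc]
    rfl
  · rw [Kernel.prod_apply]; rfl
  · rw [lintegral_prod _ hm.coe_nnreal_ennreal.aemeasurable, Measure.lintegral_compProd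
      hm.coe_nnreal_ennreal.lintegral_prod_right', lintegral_countable']
    refine tsum_congr fun w => ?_
    rw [mul_comm]
    congr 1
    have hmw : Measurable fun q : T × X × Y => ((((1 + K *
        ((posterior PTW PW q.1 {w}).toNNReal * r q.2.1 q.2.2))⁻¹ : ℝ≥0)) : ℝ≥0∞) := by
      have h1 : Measurable fun q : T × X × Y => (posterior PTW PW q.1 {w}).toNNReal :=
        (hpost w).comp measurable_fst
      have h2 : Measurable fun q : T × X × Y => r q.2.1 q.2.2 := hr.comp measurable_snd
      fun_prop
    exact lintegral_lintegral_prod_eq PX PYX (PTW w) hmw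

end Main

end BroadcastJSCC

/-! ### The theorem -/

open BroadcastJSCC in
theorem corollary1
    {W X Y T : Type*}
    [MeasurableSpace W] [Countable W] [DiscreteMeasurableSpace W] [Nonempty W]
    [MeasurableSpace X] [StandardBorelSpace X]
    [MeasurableSpace Y] [StandardBorelSpace Y]
    [MeasurableSpace T] [StandardBorelSpace T]
    (K : ℕ)
    (θX : Measure X) [SigmaFinite θX] (θY : Measure Y) [SigmaFinite θY]
    (PW : Measure W) [IsProbabilityMeasure PW]
    (PX : Measure X) [IsProbabilityMeasure PX]
    (PYX : Kernel X Y) [IsMarkovKernel PYX]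
    (PTW : Kernel W T) [IsMarkovKernel PTW]
    (hXY : PX ⊗ₘ PYX ≪ θX.prod θY) :
    -- without side information
    (∃ c : BroadcastJSCC.Code W X Y W K,
      c.errorProb PW PYX BroadcastJSCC.hammingDistortion 0 ≤
        ∫ p, (1 + (K : ℝ) * PW.real {p.1} *
          (2 : ℝ) ^ BroadcastJSCC.infoDensity θX θY (PX ⊗ₘ PYX) p.2.1 p.2.2)⁻¹
          ∂(PW.prod (PX ⊗ₘ PYX)) ∧
      -- uniform source on a finite set
      ∀ (M : ℕ) (S : Finset W), S.card = M → PW = uniformOn (S : Set W) →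
        c.errorProb PW PYX BroadcastJSCC.hammingDistortion 0 ≤
          ∫ p, (1 + (K : ℝ) * (M : ℝ)⁻¹ *
            (2 : ℝ) ^ BroadcastJSCC.infoDensity θX θY (PX ⊗ₘ PYX) p.1 p.2)⁻¹
            ∂(PX ⊗ₘ PYX)) ∧
    -- with side information
    (∃ c : BroadcastJSCC.Code W X (Y × T) W K,
      c.errorProbSI PW PYX PTW BroadcastJSCC.hammingDistortion 0 ≤
        ∫ p, (1 + (K : ℝ) * (posterior PTW PW p.1.2).real {p.1.1} *
          (2 : ℝ) ^ BroadcastJSCC.infoDensity θX θY (PX ⊗ₘ PYX) p.2.1 p.2.2)⁻¹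
          ∂((PW ⊗ₘ PTW).prod (PX ⊗ₘ PYX))) := by
  have hfst : (PX ⊗ₘ PYX).fst = PX := Measure.fst_compProd PX PYX
  have hac := absolutelyContinuous_fst_prod_snd θX θY _ hXY
  have hι := two_rpow_infoDensity_ae_eq θX θY _ hXY
  rw [hfst] at hac hι
  obtain ⟨r, hr, hdens, hle1, hrn⟩ := exists_channel_density PX PYX hac
  have hιr : ∀ᵐ p ∂(PX ⊗ₘ PYX),
      (2 : ℝ) ^ infoDensity θX θY (PX ⊗ₘ PYX) p.1 p.2 = r p.1 p.2 := by
    filter_upwards [hι, hrn] with p h1 h2 using h1.trans h2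
  refine ⟨?_, exists_code_errorProbSI_le K PW PX PYX PTW hr hdens hle1 hιr⟩
  obtain ⟨c, hbound⟩ := exists_code_errorProb_le K PW PX PYX hr hdens hle1 hιr
  refine ⟨c, hbound, fun M S hM hS => hbound.trans (le_of_eq ?_)⟩
  -- For a uniform source the integrand is almost surely free of `w`, so the source integrates out.
  have hSw : ∀ᵐ w ∂PW, PW.real {w} = (M : ℝ)⁻¹ := by
    have hmem : ∀ᵐ w ∂PW, w ∈ (S : Set W) := by
      rw [hS]
      exact ae_cond_mem (Set.toFinite _).measurableSet
    filter_upwards [hmem] with w hw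
    rw [hS, measureReal_def, uniformOn, cond_apply (Set.toFinite _).measurableSet,
      Set.inter_eq_self_of_subset_right (Set.singleton_subset_iff.2 hw), Measure.count_singleton,
      Measure.count_apply_finset, hM]
    simp
  rw [integral_congr_ae (g := fun p : W × X × Y => (1 + (K : ℝ) * (M : ℝ)⁻¹ *
    (2 : ℝ) ^ infoDensity θX θY (PX ⊗ₘ PYX) p.2.1 p.2.2)⁻¹)]
  · rw [integral_fun_snd (μ := PW) (ν := PX ⊗ₘ PYX) (fun q : X × Y => (1 + (K : ℝ) * (M : ℝ)⁻¹ *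
      (2 : ℝ) ^ infoDensity θX θY (PX ⊗ₘ PYX) q.1 q.2)⁻¹)]
    simp
  · filter_upwards [Measure.quasiMeasurePreserving_fst.ae hSw] with p hp
    rw [hp]
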